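/- Let $\mathbb S^m$ be the space of real symmetric $m\times m$ matrices with inner product $\langle Y,Z\rangle=\operatorname{tr}(YZ)$ and Frobenius norm $\|\cdot\|_F$, let $\mathbb S^m_+\subset\mathbb S^m$ be the cone of positive semidefinite matrices, $P$ the projection onto $\mathbb S^m_+$ in this norm, and $Y\circ Z=\tfrac12(YZ+ZY)$, $\mathcal L_Y(Z)=Y\circ Z$. Let $f:\mathbb R^n\to\mathbb R$ and $G:\mathbb R^n\to\mathbb S^m$ be twice continuously differentiable, and consider the problem $$\text{(NSDP)}\qquad \min_x f(x)\quad\text{subject to}\quad G(x)\in\mathbb S^m_+ .$$ Assume that every feasible $x$ is nondegenerate, that is, $\mathbb S^m=\operatorname{lin}\mathcal T_{\mathbb S^m_+}(G(x))+\operatorname{Im}\nabla G(x)$, where $\mathcal T_{\mathbb S^m_+}(G(x))$ is the tangent cone of $\mathbb S^m_+$ at $G(x)$, $\operatorname{lin}$ denotes the lineality space, and $\nabla G(x):\mathbb R^n\to\mathbb S^m$ is the derivative of $G$ at $x$, with adjoint $\nabla G(x)^*$. A pair $(x,\Lambda)\in\mathbb R^n\times\mathbb S^m$ is a KKT pair of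 (NSDP) if $\nabla_xL(x,\Lambda)=0$, where $L(x,\Lambda)=f(x)-\langle G(x),\Lambda\rangle$, and $\Lambda\circ G(x)=0$, $G(x)\in\mathbb S^m_+$, $\Lambda\in\mathbb S^m_+$. Fix $\zeta_1,\zeta_2>0$ and put $$r(x)=\tfrac12\|P(-G(x))\|_F^2,\qquad N(x)=\nabla G(x)\nabla G(x)^*+\zeta_1^2\mathcal L_{G(x)}^2+\zeta_2^2r(x)I,\qquad \Lambda(x)=N(x)^{-1}\nabla G(x)\nabla f(x),$$ and, for $c>0$, $$L_c(x,\Lambda)=f(x)+\frac1{2c}\left(\|P(\Lambda-cG(x))\|_F^2-\|\Lambda\|_F^2\right)+\|N(x)(\Lambda(x)-\Lambda)\|_F^2 .$$ Let $\{x^k\}\subset\mathbb R^n$, $\{\Lambda_k\}\subset\mathbb S^m$ and $\{c_k\}\subset(0,\infty)$ be sequences such that $c_k\to\infty$ and, for every $k$, $(x^k,\Lambda_k)$ is a stationary point of $L_{c_k}$ on $\mathbb R^n\times\mathbb S^m$ (its gradient with respect to $(x,\Lambda)$ vanishes there). Assume that along some subsequence $x^{k_j}\to\hat x$ and $\Lambda_{k_j}\to\hat\Lambda$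 for some $(\hat x,\hat\Lambda)\in\mathbb R^n\times\mathbb S^m$. Then either there exists $\hat k>0$ such that $(x^{k_j},\Lambda_{k_j})$ is a KKT pair of (NSDP) for all $k_j\ge\hat k$, or $\hat x$ is a stationary point of $r$ that is infeasible for (NSDP). -/

import Mathlib

open Filter Topology
open scoped Pointwise

noncomputable section

/-- A real symmetric `m × m` matrix. -/
@[ext]
structure SymMat (m : ℕ) where
  val : Matrix (Fin m) (Fin m) ℝ
  isSymm : val.IsSymm

namespace SymMat

variable {m : ℕ}

instance : Zero (SymMat m) := ⟨⟨0, Matrix.isSymm_zero⟩⟩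
instance : Add (SymMat m) := ⟨fun A B => ⟨A.1 + B.1, A.2.add B.2⟩⟩
instance : Neg (SymMat m) := ⟨fun A => ⟨-A.1, A.2.neg⟩⟩
instance : Sub (SymMat m) := ⟨fun A B => ⟨A.1 - B.1, A.2.sub B.2⟩⟩
instance : SMul ℕ (SymMat m) := ⟨fun k A => ⟨k • A.1, A.2.smul k⟩⟩
instance : SMul ℤ (SymMat m) := ⟨fun k A => ⟨k • A.1, A.2.smul k⟩⟩
instance : SMul ℝ (SymMat m) := ⟨fun r A => ⟨r • A.1, A.2.smul r⟩⟩

@[simp] lemma val_zero : (0 : SymMat m).1 = 0 := rfl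
@[simp] lemma val_add (A B : SymMat m) : (A + B).1 = A.1 + B.1 := rfl
@[simp] lemma val_neg (A : SymMat m) : (-A).1 = -A.1 := rfl
@[simp] lemma val_sub (A B : SymMat m) : (A - B).1 = A.1 - B.1 := rfl
@[simp] lemma val_smul (r : ℝ) (A : SymMat m) : (r • A).1 = r • A.1 := rfl

lemma val_injective : Function.Injective (val : SymMat m → Matrix (Fin m) (Fin m) ℝ) :=
  fun _ _ h => SymMat.ext h

/-- The entrywise operations make `𝕊^m` a real vector space. -/
instance : AddCommGroup (SymMat m) :=
  val_injective.addCommGroup val rfl (fun _ _ => rfl) (fun _ => rfl) (fun _ _ => rfl)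
    (fun _ _ => rfl) (fun _ _ => rfl)

/-- The inclusion of `𝕊^m` into all matrices, as an additive map. -/
def valHom (m : ℕ) : SymMat m →+ Matrix (Fin m) (Fin m) ℝ where
  toFun := val
  map_zero' := rfl
  map_add' _ _ := rfl

instance : Module ℝ (SymMat m) := val_injective.module ℝ (valHom m) (fun _ _ => rfl)

instance : FiniteDimensional ℝ (SymMat m) :=
  Module.Finite.of_injective
    ({ toFun := val, map_add' := fun _ _ => rfl, map_smul' := fun _ _ => rfl } :
      SymMat m →ₗ[ℝ] Matrix (Fin m) (Fin m) ℝ) val_injective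

lemma trace_mul_self_eq (A : SymMat m) :
    (A.1 * A.1).trace = ∑ i, ∑ j, A.1 i j ^ 2 := by
  simp only [Matrix.trace, Matrix.diag, Matrix.mul_apply]
  refine Finset.sum_congr rfl fun i _ => Finset.sum_congr rfl fun j _ => ?_
  rw [A.2.apply i j, sq]

/-- The trace inner product `⟨Y, Z⟩ = tr (Y Z)` on `𝕊^m`. -/
@[reducible] def innerCore (m : ℕ) : InnerProductSpace.Core ℝ (SymMat m) where
  inner Y Z := (Y.1 * Z.1).trace
  conj_inner_symm Y Z := by simp [Matrix.trace_mul_comm Z.1 Y.1]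
  re_inner_nonneg Y := by
    simp only [trace_mul_self_eq, RCLike.re_to_real]
    positivity
  add_left X Y Z := by simp [add_mul]
  smul_left Y Z r := by simp
  definite Y h := by
    rw [trace_mul_self_eq] at h
    apply SymMat.ext
    ext i j
    have h1 := (Finset.sum_eq_zero_iff_of_nonneg
      (fun i _ => Finset.sum_nonneg fun j _ => sq_nonneg (Y.1 i j))).1 h i (Finset.mem_univ i)
    have h2 := (Finset.sum_eq_zero_iff_of_nonneg
      (fun j _ => sq_nonneg (Y.1 i j))).1 h1 j (Finset.mem_univ j)
    simpa using h2

instance : NormedAddCommGroup (SymMat m) := (innerCore m).toNormedAddCommGroup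

instance : InnerProductSpace ℝ (SymMat m) := .ofCore (innerCore m).toCore

instance : CompleteSpace (SymMat m) := FiniteDimensional.complete ℝ (SymMat m)

lemma inner_def (Y Z : SymMat m) : inner ℝ Y Z = (Y.1 * Z.1).trace := rfl

/-- The cone `𝕊^m_+` of positive semidefinite matrices. -/
def psd (m : ℕ) : Set (SymMat m) := {Z | Z.1.PosSemidef}

lemma mem_psd_iff (Z : SymMat m) :
    Z ∈ psd m ↔ ∀ v : Fin m → ℝ, 0 ≤ dotProduct v (Z.1.mulVec v) := by
  have hZ : Z.1.IsHermitian := by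
    have := Z.2
    rw [Matrix.IsSymm] at this
    rw [Matrix.IsHermitian, Matrix.conjTranspose_eq_transpose_of_trivial, this]
  rw [psd, Set.mem_ofPred_eq, Matrix.posSemidef_iff_dotProduct_mulVec]
  simp only [star_trivial]
  exact and_iff_right hZ

/-- The quadratic form `v ↦ vᵀ Z v` as a linear function of `Z`. -/
def quadForm (v : Fin m → ℝ) : SymMat m →ₗ[ℝ] ℝ where
  toFun Z := dotProduct v (Z.1.mulVec v)
  map_add' Y Z := by simp [Matrix.add_mulVec]
  map_smul' r Z := by simp [Matrix.smul_mulVec]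

lemma zero_mem_psd : (0 : SymMat m) ∈ psd m := by simp [mem_psd_iff]

lemma convex_psd : Convex ℝ (psd m) := by
  intro Y hY Z hZ a b ha hb _
  rw [mem_psd_iff] at *
  intro v
  have := add_nonneg (mul_nonneg ha (hY v)) (mul_nonneg hb (hZ v))
  simpa [Matrix.add_mulVec, Matrix.smul_mulVec] using this

lemma isClosed_psd : IsClosed (psd m) := by
  have : psd m = ⋂ v : Fin m → ℝ, {Z | 0 ≤ quadForm v Z} := by
    ext Z
    simp [mem_psd_iff, quadForm]
  rw [this]
  exact isClosed_iInter fun v =>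
    isClosed_le continuous_const (quadForm v).continuous_of_finiteDimensional

lemma exists_proj (Z : SymMat m) : ∃ W ∈ psd m, ∀ V ∈ psd m, ‖Z - W‖ ≤ ‖Z - V‖ := by
  obtain ⟨W, hW, h⟩ := exists_norm_eq_iInf_of_complete_convex ⟨0, zero_mem_psd⟩
    (isClosed_psd (m := m)).isComplete convex_psd Z
  refine ⟨W, hW, fun V hV => h ▸ ?_⟩
  exact ciInf_le ⟨0, Set.forall_mem_range.2 fun _ => norm_nonneg _⟩ (⟨V, hV⟩ : psd m)

/-- The projection `P` onto the cone `𝕊^m_+`: the (unique) positive semidefinite matrix nearest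
to `Z` in the Frobenius norm. -/
def proj (Z : SymMat m) : SymMat m := Classical.choose (exists_proj Z)

lemma proj_mem (Z : SymMat m) : proj Z ∈ psd m := (Classical.choose_spec (exists_proj Z)).1

lemma norm_sub_proj_le (Z : SymMat m) {V : SymMat m} (hV : V ∈ psd m) :
    ‖Z - proj Z‖ ≤ ‖Z - V‖ := (Classical.choose_spec (exists_proj Z)).2 V hV

/-- The Jordan product `Y ∘ Z = (Y Z + Z Y) / 2`. -/
def jordan (Y Z : SymMat m) : SymMat m :=
  ⟨(2⁻¹ : ℝ) • (Y.1 * Z.1 + Z.1 * Y.1), by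
    have hY : Y.1.transpose = Y.1 := Y.2
    have hZ : Z.1.transpose = Z.1 := Z.2
    rw [Matrix.IsSymm, Matrix.transpose_smul, Matrix.transpose_add, Matrix.transpose_mul,
      Matrix.transpose_mul, hY, hZ, add_comm]⟩

/-- The linear operator `ℒ_Y : Z ↦ Y ∘ Z` on `𝕊^m`. -/
def jordanL (Y : SymMat m) : SymMat m →L[ℝ] SymMat m :=
  LinearMap.toContinuousLinearMap
    { toFun := jordan Y
      map_add' := fun A B => SymMat.ext <| by
        change (2⁻¹ : ℝ) • (Y.1 * (A.1 + B.1) + (A.1 + B.1) * Y.1)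
          = (2⁻¹ : ℝ) • (Y.1 * A.1 + A.1 * Y.1) + (2⁻¹ : ℝ) • (Y.1 * B.1 + B.1 * Y.1)
        rw [← smul_add, mul_add, add_mul]
        congr 1
        abel
      map_smul' := fun r A => SymMat.ext <| by
        change (2⁻¹ : ℝ) • (Y.1 * (r • A.1) + (r • A.1) * Y.1)
          = r • ((2⁻¹ : ℝ) • (Y.1 * A.1 + A.1 * Y.1))
        rw [mul_smul_comm, smul_mul_assoc, ← smul_add, smul_comm] }

end SymMat

namespace NSDP

variable {n m : ℕ}

/-- `p` is a stationary point of `ψ`: the derivative of `ψ` at `p` exists and vanishes. -/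
def IsStationary {E : Type*} [NormedAddCommGroup E] [NormedSpace ℝ E] (ψ : E → ℝ) (p : E) : Prop :=
  HasFDerivAt ψ (0 : E →L[ℝ] ℝ) p

/-- The lineality space `T ∩ (-T)` of a convex cone `T`. -/
def lineality {E : Type*} [AddCommGroup E] (T : Set E) : Set E := {w | w ∈ T ∧ -w ∈ T}

/-- Feasibility of `x` for the problem of minimizing `f` subject to `G x ∈ 𝕊^m_+`. -/
def IsFeasible (G : EuclideanSpace ℝ (Fin n) → SymMat m) (x : EuclideanSpace ℝ (Fin n)) : Prop :=
  G x ∈ SymMat.psd m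

/-- Nondegeneracy of a point: `𝕊^m = lin T_{𝕊^m_+}(G x) + Im ∇G(x)`. -/
def IsNondegenerate (G : EuclideanSpace ℝ (Fin n) → SymMat m)
    (x : EuclideanSpace ℝ (Fin n)) : Prop :=
  lineality (posTangentConeAt (SymMat.psd m) (G x)) + Set.range (fderiv ℝ G x) = Set.univ

/-- The Lagrangian `L(x, Λ) = f(x) - ⟨G(x), Λ⟩`. -/
def lagrangian (f : EuclideanSpace ℝ (Fin n) → ℝ) (G : EuclideanSpace ℝ (Fin n) → SymMat m)
    (x : EuclideanSpace ℝ (Fin n)) (Λ : SymMat m) : ℝ :=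
  f x - inner ℝ (G x) Λ

/-- `(x, Λ)` is a KKT pair. -/
structure IsKKT (f : EuclideanSpace ℝ (Fin n) → ℝ) (G : EuclideanSpace ℝ (Fin n) → SymMat m)
    (x : EuclideanSpace ℝ (Fin n)) (Λ : SymMat m) : Prop where
  stationary : IsStationary (fun y => lagrangian f G y Λ) x
  complementarity : SymMat.jordan Λ (G x) = 0
  feasible : IsFeasible G x
  multiplier : Λ ∈ SymMat.psd m

/-- The residual `r(x) = ½ ‖P(-G(x))‖²`. -/
def residual (G : EuclideanSpace ℝ (Fin n) → SymMat m) (x : EuclideanSpace ℝ (Fin n)) : ℝ :=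
  1 / 2 * ‖SymMat.proj (-G x)‖ ^ 2

/-- `N(x) = ∇G(x) ∇G(x)^* + ζ₁² ℒ_{G(x)}² + ζ₂² r(x) I`, an operator on `𝕊^m`. -/
def opN (G : EuclideanSpace ℝ (Fin n) → SymMat m) (ζ₁ ζ₂ : ℝ) (x : EuclideanSpace ℝ (Fin n)) :
    SymMat m →L[ℝ] SymMat m :=
  fderiv ℝ G x ∘L ContinuousLinearMap.adjoint (fderiv ℝ G x)
    + ζ₁ ^ 2 • (SymMat.jordanL (G x) ∘L SymMat.jordanL (G x))
    + (ζ₂ ^ 2 * residual G x) • ContinuousLinearMap.id ℝ (SymMat m)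

/-- The multiplier estimate `Λ(x) = N(x)⁻¹ ∇G(x) ∇f(x)`. -/
def multiplierEstimate (f : EuclideanSpace ℝ (Fin n) → ℝ)
    (G : EuclideanSpace ℝ (Fin n) → SymMat m) (ζ₁ ζ₂ : ℝ) (x : EuclideanSpace ℝ (Fin n)) :
    SymMat m :=
  (opN G ζ₁ ζ₂ x).inverse (fderiv ℝ G x (gradient f x))

/-- The augmented Lagrangian
`L_c(x, Λ) = f(x) + (‖P(Λ - c G(x))‖² - ‖Λ‖²) / (2c) + ‖N(x) (Λ(x) - Λ)‖²`. -/
def augLagrangian (f : EuclideanSpace ℝ (Fin n) → ℝ) (G : EuclideanSpace ℝ (Fin n) → SymMat m)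
    (ζ₁ ζ₂ c : ℝ) (p : EuclideanSpace ℝ (Fin n) × SymMat m) : ℝ :=
  f p.1 + 1 / (2 * c) * (‖SymMat.proj (p.2 - c • G p.1)‖ ^ 2 - ‖p.2‖ ^ 2)
    + ‖opN G ζ₁ ζ₂ p.1 (multiplierEstimate f G ζ₁ ζ₂ p.1 - p.2)‖ ^ 2

end NSDP

end

/-! Write `U = P(Λ - cG(x))`, `S = (U - Λ)/c` (`multiplierStep`), `F = N(x)(Λ(x) - Λ)`, and `D` for
the `x`-derivative of `F`. Since `½‖P(·)‖²` has gradient `P`, stationarity of `L_c` means `S = 2 N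
F` in the `Λ` direction and `∇G^* U = ∇f + 2 D^* F` in the `x` direction. If `S = 0`, then `U = Λ`,
and injectivity of `N` gives `F = 0`; these equations together with Moreau's decomposition are the
KKT conditions.

Along the subsequence `S → P(-G(xhat))`. Dividing the `x` equation by `c` gives `∇G(xhat)^*
P(-G(xhat)) = 0`, so the limit is always stationary for `r`. If it is feasible, then `S → 0`, and it
remains to show that `S` vanishes eventually. Nondegeneracy makes `M = ∇G ∇G^* + ζ₁² ℒ_G²` injective
at the limit, hence bounded below nearby. Complementarity of `U` and `G + S` gives `G ∘ U = -S ∘ U`,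
so every term of `M(U - Λ) = c M S` carries a factor `‖S‖` (`opM_shiftProj_sub`,
`norm_shiftProj_sub_le`). For `S ≠ 0`, cancelling that factor bounds a fixed `σ > 0` by a quantity
of the form `C/c + C'‖S‖`, which tends to zero. -/

namespace SymMat

variable {m : ℕ}

/-! ### Projection onto the positive semidefinite cone -/

lemma smul_mem_psd {Z : SymMat m} (hZ : Z ∈ psd m) {a : ℝ} (ha : 0 ≤ a) : a • Z ∈ psd m := by
  rw [mem_psd_iff] at *
  intro v
  simpa [Matrix.smul_mulVec] using mul_nonneg ha (hZ v)

/-- The rank one matrix `v vᵀ`. -/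
def vecSq (v : Fin m → ℝ) : SymMat m :=
  ⟨Matrix.vecMulVec v v, by
    rw [Matrix.IsSymm]; ext i j; simp [Matrix.vecMulVec_apply, mul_comm]⟩

lemma inner_vecSq (Z : SymMat m) (v : Fin m → ℝ) :
    inner ℝ Z (vecSq v) = dotProduct v (Z.1.mulVec v) := by
  rw [inner_def, vecSq, Matrix.mul_vecMulVec, Matrix.trace_vecMulVec, dotProduct_comm]

lemma vecSq_mem_psd (v : Fin m → ℝ) : vecSq v ∈ psd m := by
  rw [mem_psd_iff]
  intro w
  have : w ⬝ᵥ (vecSq v).1.mulVec w = (w ⬝ᵥ v) ^ 2 := by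
    rw [vecSq, Matrix.vecMulVec_mulVec]
    simp [dotProduct_smul, dotProduct_comm v w, sq]
  rw [this]
  positivity

lemma inner_sub_proj_le (Z : SymMat m) {V : SymMat m} (hV : V ∈ psd m) :
    inner ℝ (Z - proj Z) (V - proj Z) ≤ 0 := by
  refine (norm_eq_iInf_iff_real_inner_le_zero convex_psd (proj_mem Z)).1 ?_ V hV
  have : Nonempty (psd m) := ⟨⟨0, zero_mem_psd⟩⟩
  refine le_antisymm (le_ciInf fun W => norm_sub_proj_le Z W.2) ?_
  exact ciInf_le ⟨0, Set.forall_mem_range.2 fun _ => norm_nonneg _⟩ (⟨_, proj_mem Z⟩ : psd m)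

lemma inner_sub_proj_proj (Z : SymMat m) : inner ℝ (Z - proj Z) (proj Z) = (0 : ℝ) := by
  have h0 := inner_sub_proj_le Z zero_mem_psd
  have h2 := inner_sub_proj_le Z (smul_mem_psd (proj_mem Z) zero_le_two)
  rw [inner_sub_right] at h0 h2
  rw [inner_smul_right] at h2
  rw [inner_zero_right] at h0
  linarith

lemma inner_proj_self (Z : SymMat m) : inner ℝ Z (proj Z) = ‖proj Z‖ ^ 2 := by
  have h := inner_sub_proj_proj Z
  rw [inner_sub_left, real_inner_self_eq_norm_sq] at h
  linarith

lemma inner_le_inner_proj (Z : SymMat m) {V : SymMat m} (hV : V ∈ psd m) :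
    inner ℝ Z V ≤ (inner ℝ (proj Z) V : ℝ) := by
  have h := inner_sub_proj_le Z hV
  have h' := inner_sub_proj_proj Z
  rw [inner_sub_right] at h
  rw [inner_sub_left] at h
  linarith

lemma proj_sub_self_mem_psd (Z : SymMat m) : proj Z - Z ∈ psd m := by
  rw [mem_psd_iff]
  intro v
  have h := inner_le_inner_proj Z (vecSq_mem_psd v)
  rw [← inner_vecSq, inner_sub_left]
  linarith

/-- Moreau's characterization of the projection onto the positive semidefinite cone. -/
lemma proj_eq_of {Z U : SymMat m} (hU : U ∈ psd m)
    (hU' : ∀ V ∈ psd m, inner ℝ Z V ≤ (inner ℝ U V : ℝ))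
    (h : inner ℝ (Z - U) U = (0 : ℝ)) : proj Z = U := by
  have h1 := hU' _ (proj_mem Z)
  have h2 := inner_sub_proj_le Z hU
  have h3 : inner ℝ (proj Z - U) (proj Z - U) ≤ (0 : ℝ) := by
    simp only [inner_sub_left, inner_sub_right, real_inner_comm U (proj Z)] at *
    linarith
  exact sub_eq_zero.1 (real_inner_self_nonpos.1 h3)

lemma proj_smul (Z : SymMat m) {a : ℝ} (ha : 0 ≤ a) : proj (a • Z) = a • proj Z := by
  refine proj_eq_of (smul_mem_psd (proj_mem Z) ha) (fun V hV => ?_) ?_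
  · rw [inner_smul_left, inner_smul_left]
    exact mul_le_mul_of_nonneg_left (inner_le_inner_proj Z hV) ha
  · rw [← smul_sub, inner_smul_left, inner_smul_right, inner_sub_proj_proj]
    simp

lemma norm_proj_sub_proj_le (Y Z : SymMat m) : ‖proj Y - proj Z‖ ≤ ‖Y - Z‖ := by
  have h1 := inner_sub_proj_le Y (proj_mem Z)
  have h2 := inner_sub_proj_le Z (proj_mem Y)
  have h3 : ‖proj Y - proj Z‖ ^ 2 ≤ inner ℝ (Y - Z) (proj Y - proj Z) := by
    rw [← real_inner_self_eq_norm_sq]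
    simp only [inner_sub_left, inner_sub_right, real_inner_comm (proj Z) (proj Y)] at *
    linarith
  have h4 := real_inner_le_norm (Y - Z) (proj Y - proj Z)
  rcases (norm_nonneg (proj Y - proj Z)).eq_or_lt with h | h
  · rw [← h]; exact norm_nonneg _
  · nlinarith

lemma continuous_proj : Continuous (proj : SymMat m → SymMat m) :=
  (LipschitzWith.of_dist_le_mul (K := 1) fun Y Z => by
    simpa [dist_eq_norm] using norm_proj_sub_proj_le Y Z).continuous

/-- The subgradient inequality for `½‖P(·)‖²`. It follows from `⟨Y, P(Z)⟩ ≤ ⟨P(Y), P(Z)⟩ ≤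
‖P(Y)‖‖P(Z)‖` and the arithmetic-geometric mean inequality. -/
lemma half_norm_sq_proj_ge (Y Z : SymMat m) :
    1 / 2 * ‖proj Z‖ ^ 2 + inner ℝ (proj Z) (Y - Z) ≤ 1 / 2 * ‖proj Y‖ ^ 2 := by
  have h1 := inner_le_inner_proj Y (proj_mem Z)
  have h2 := inner_proj_self Z
  have h3 := real_inner_le_norm (proj Y) (proj Z)
  rw [inner_sub_right, real_inner_comm, real_inner_comm Z, h2]
  nlinarith [sq_nonneg (‖proj Y‖ - ‖proj Z‖)]

/-- The subgradient inequality at both points traps the remainder between `0` and `⟨P(Y) - P(Z), Y -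
Z⟩`, which is at most `‖Y - Z‖²` because `P` is nonexpansive. -/
lemma hasFDerivAt_half_norm_sq_proj (Z : SymMat m) :
    HasFDerivAt (fun Y => 1 / 2 * ‖proj Y‖ ^ 2) (innerSL ℝ (proj Z)) Z := by
  rw [hasFDerivAt_iff_isLittleO]
  refine Asymptotics.IsBigO.trans_isLittleO (g := fun Y => ‖Y - Z‖ ^ 2)
    (Asymptotics.IsBigO.of_bound 1 (Eventually.of_forall fun Y => ?_)) ?_
  · have h1 := half_norm_sq_proj_ge Y Z
    have h2 := half_norm_sq_proj_ge Z Y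
    have h3 := real_inner_le_norm (proj Y - proj Z) (Y - Z)
    have h4 := norm_proj_sub_proj_le Y Z
    have h5 := mul_le_mul_of_nonneg_right h4 (norm_nonneg (Y - Z))
    rw [← neg_sub Y Z, inner_neg_right] at h2
    rw [inner_sub_left] at h3
    rw [innerSL_apply_apply, Real.norm_of_nonneg (by linarith), norm_pow, norm_norm]
    nlinarith
  · have : Tendsto (fun Y => ‖Y - Z‖) (𝓝 Z) (𝓝 0) := by
      have : Continuous fun Y : SymMat m => ‖Y - Z‖ := by fun_prop
      simpa using this.tendsto Z
    have h := (Asymptotics.isLittleO_one_iff ℝ).2 this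
    have h' := h.mul_isBigO (Asymptotics.isBigO_refl (fun Y : SymMat m => ‖Y - Z‖) (𝓝 Z))
    simpa [sq] using h'.norm_right

/-! ### Complementarity and tangent directions in the semidefinite cone -/

open scoped MatrixOrder in
lemma exists_eq_transpose_mul_self {U : SymMat m} (hU : U ∈ psd m) :
    ∃ C : Matrix (Fin m) (Fin m) ℝ, U.1 = C.transpose * C := by
  obtain ⟨C, hC⟩ := CStarAlgebra.nonneg_iff_eq_star_mul_self.1 (Matrix.nonneg_iff_posSemidef.2 hU)
  exact ⟨C, by simpa [Matrix.star_eq_conjTranspose] using hC⟩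

lemma inner_nonneg_of_mem_psd {U W : SymMat m} (hU : U ∈ psd m) (hW : W ∈ psd m) :
    0 ≤ (inner ℝ U W : ℝ) := by
  obtain ⟨C, hC⟩ := exists_eq_transpose_mul_self hW
  rw [inner_def, hC, ← Matrix.mul_assoc, Matrix.trace_mul_comm, ← Matrix.mul_assoc]
  exact (Matrix.PosSemidef.mul_mul_conjTranspose_same hU C).trace_nonneg

/-- With `U = CᵀC` the trace is the squared Frobenius norm of `C B`. -/
lemma mul_eq_zero_of_trace_eq_zero {U : SymMat m} (hU : U ∈ psd m) (B : Matrix (Fin m) (Fin m) ℝ)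
    (h : (B.transpose * U.1 * B).trace = 0) : U.1 * B = 0 := by
  obtain ⟨C, hC⟩ := exists_eq_transpose_mul_self hU
  have h1 : (Matrix.conjTranspose (C * B) * (C * B)).trace = 0 := by
    rw [Matrix.conjTranspose_eq_transpose_of_trivial, Matrix.transpose_mul, ← h, hC]
    simp only [Matrix.mul_assoc]
  rw [hC, Matrix.mul_assoc, Matrix.trace_conjTranspose_mul_self_eq_zero_iff.1 h1, Matrix.mul_zero]

lemma jordan_eq_zero_of_mul_eq_zero {U W : SymMat m} (h : U.1 * W.1 = 0) : jordan U W = 0 := by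
  have h' : W.1 * U.1 = 0 := by
    have := congrArg Matrix.transpose h
    rwa [Matrix.transpose_mul, U.2, W.2, Matrix.transpose_zero] at this
  ext1
  simp [jordan, h, h']

lemma jordan_eq_zero_of_inner_eq_zero {U W : SymMat m} (hU : U ∈ psd m) (hW : W ∈ psd m)
    (h : inner ℝ U W = (0 : ℝ)) : jordan U W = 0 := by
  obtain ⟨C, hC⟩ := exists_eq_transpose_mul_self hW
  apply jordan_eq_zero_of_mul_eq_zero
  rw [hC, ← Matrix.mul_assoc, mul_eq_zero_of_trace_eq_zero hU, Matrix.zero_mul]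
  rw [inner_def, hC, ← Matrix.mul_assoc, Matrix.trace_mul_comm] at h
  rwa [Matrix.transpose_transpose, Matrix.mul_assoc]

/-- Multiplying `YZ + ZY = 0` by `Z` and taking traces gives `2 tr(ZYZ) = 0`. Only `Y` has to be
semidefinite. -/
lemma mul_eq_zero_of_jordan_eq_zero {Y Z : SymMat m} (hY : Y ∈ psd m) (h : jordan Y Z = 0) :
    Y.1 * Z.1 = 0 := by
  apply mul_eq_zero_of_trace_eq_zero hY
  have h1 : Y.1 * Z.1 + Z.1 * Y.1 = 0 := by
    exact (smul_eq_zero_iff_right (by norm_num : (2⁻¹ : ℝ) ≠ 0)).1 (congrArg val h)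
  have h2 : (Z.1 * (Y.1 * Z.1 + Z.1 * Y.1)).trace = 0 := by rw [h1]; simp
  rw [Matrix.mul_add, Matrix.trace_add, ← Matrix.mul_assoc Z.1 Z.1, Matrix.mul_assoc Z.1 Z.1,
    Matrix.trace_mul_comm Z.1 (Z.1 * Y.1), Matrix.mul_assoc, ← Matrix.mul_assoc] at h2
  rw [show Z.1.transpose = Z.1 from Z.2]
  linarith

lemma jordan_comm (Y Z : SymMat m) : jordan Y Z = jordan Z Y := by
  ext1
  simp only [jordan, add_comm]

open scoped MatrixOrder in
/-- A matrix annihilated by a positive semidefinite matrix `Y` is orthogonal to the lineality space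
of the tangent cone at `Y`. -/
lemma inner_eq_zero_of_mem_lineality {Y Z H : SymMat m} (hYZ : Y.1 * Z.1 = 0)
    (hH : H ∈ NSDP.lineality (posTangentConeAt (psd m) Y)) : inner ℝ Z H = (0 : ℝ) := by
  -- For `v` in the kernel of `Y`, the form `V ↦ vᵀVv` is nonnegative on the cone and zero at `Y`,
  -- so `Y` minimizes it there. The first-order condition along both `H` and `-H` makes the
  -- derivative vanish.
  have key (v : Fin m → ℝ) (hv : Y.1.mulVec v = 0) : v ⬝ᵥ H.1.mulVec v = 0 := by
    have hmin : IsLocalMinOn (LinearMap.toContinuousLinearMap (quadForm v)) (psd m) Y := by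
      refine IsMinOn.localize fun V hV => ?_
      have := (mem_psd_iff V).1 hV v
      simpa [quadForm, hv] using this
    exact hmin.hasFDerivWithinAt_eq_zero
      (LinearMap.toContinuousLinearMap (quadForm v)).hasFDerivAt.hasFDerivWithinAt hH.1 hH.2
  -- The range of `Z` lies in the kernel of `Y`, so `ZHZ` has zero quadratic form and vanishes. Then
  -- `(ZH)² = 0`, and a nilpotent matrix has trace zero; no diagonalization is needed.
  let K : SymMat m := ⟨Z.1 * H.1 * Z.1, by
    rw [Matrix.IsSymm, Matrix.transpose_mul, Matrix.transpose_mul, Z.2, H.2, Matrix.mul_assoc]⟩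
  have hK (w : Fin m → ℝ) : w ⬝ᵥ K.1.mulVec w = 0 := by
    have := key (Z.1.mulVec w) (by rw [Matrix.mulVec_mulVec, hYZ, Matrix.zero_mulVec])
    rw [show K.1 = Z.1 * (H.1 * Z.1) from Matrix.mul_assoc _ _ _, ← Matrix.mulVec_mulVec,
      Matrix.dotProduct_mulVec, ← Matrix.mulVec_transpose, Z.2, ← Matrix.mulVec_mulVec]
    exact this
  have h1 : K ∈ psd m := (mem_psd_iff _).2 fun w => (hK w).ge
  have h2 : -K ∈ psd m := (mem_psd_iff _).2 fun w => by
    simp [Matrix.neg_mulVec, hK]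
  have h3 : Z.1 * H.1 * Z.1 = 0 :=
    le_antisymm (neg_nonneg.1 (Matrix.nonneg_iff_posSemidef.2 h2))
      (Matrix.nonneg_iff_posSemidef.2 h1)
  have h4 : IsNilpotent (Z.1 * H.1) := ⟨2, by
    rw [sq, ← Matrix.mul_assoc, h3, Matrix.zero_mul]⟩
  exact (Matrix.isNilpotent_trace_of_isNilpotent h4).eq_zero

lemma jordan_proj_proj_sub (Z : SymMat m) : jordan (proj Z) (proj Z - Z) = 0 := by
  refine jordan_eq_zero_of_inner_eq_zero (proj_mem Z) (proj_sub_self_mem_psd Z) ?_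
  rw [← neg_sub, inner_neg_right, real_inner_comm, inner_sub_proj_proj, neg_zero]

lemma proj_neg_eq_zero_iff (Z : SymMat m) : proj (-Z) = 0 ↔ Z ∈ psd m := by
  constructor
  · intro h
    have := proj_sub_self_mem_psd (-Z)
    simpa [h] using this
  · intro h
    refine proj_eq_of zero_mem_psd (fun V hV => ?_) (by simp)
    simpa using inner_nonneg_of_mem_psd h hV

/-- Nonexpansiveness compares `-Z` with `-(Z + S)`, whose projection is zero. -/
lemma norm_proj_neg_le {Z S : SymMat m} (h : Z + S ∈ psd m) : ‖proj (-Z)‖ ≤ ‖S‖ := by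
  have h1 := norm_proj_sub_proj_le (-Z) (-(Z + S))
  rw [(proj_neg_eq_zero_iff _).2 h] at h1
  simpa using h1

/-- `ℒ` as a continuous linear map in both arguments. -/
noncomputable def jordanCLM (m : ℕ) : SymMat m →L[ℝ] SymMat m →L[ℝ] SymMat m :=
  LinearMap.toContinuousLinearMap
    { toFun := jordanL
      map_add' := fun Y Z => by
        ext1 A
        change jordan (Y + Z) A = jordan Y A + jordan Z A
        simp only [jordan_comm _ A]
        exact (jordanL A).map_add Y Z
      map_smul' := fun a Y => by
        ext1 A
        change jordan (a • Y) A = a • jordan Y A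
        simp only [jordan_comm _ A]
        exact (jordanL A).map_smul a Y }

@[simp] lemma jordanCLM_apply (Y : SymMat m) : jordanCLM m Y = jordanL Y := rfl

lemma inner_jordanL_left (Y A B : SymMat m) :
    inner ℝ (jordanL Y A) B = (inner ℝ A (jordanL Y B) : ℝ) := by
  change ((2⁻¹ : ℝ) • (Y.1 * A.1 + A.1 * Y.1) * B.1).trace
    = (A.1 * ((2⁻¹ : ℝ) • (Y.1 * B.1 + B.1 * Y.1))).trace
  rw [smul_mul_assoc, mul_smul_comm, Matrix.trace_smul, Matrix.trace_smul, add_mul, mul_add,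
    Matrix.trace_add, Matrix.trace_add, Matrix.mul_assoc Y.1, Matrix.trace_mul_comm Y.1,
    ← Matrix.mul_assoc A.1 B.1, ← Matrix.mul_assoc A.1 Y.1, add_comm]

end SymMat

namespace NSDP

variable {n m : ℕ} {f : EuclideanSpace ℝ (Fin n) → ℝ} {G : EuclideanSpace ℝ (Fin n) → SymMat m}

/-! ### Smoothness of `r` and `N`, and injectivity of `N` -/

lemma hasFDerivAt_residual {x : EuclideanSpace ℝ (Fin n)} (hG : DifferentiableAt ℝ G x) :
    HasFDerivAt (residual G) (-(innerSL ℝ (SymMat.proj (-G x)) ∘L fderiv ℝ G x)) x := by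
  have h := (SymMat.hasFDerivAt_half_norm_sq_proj (-G x)).comp x hG.hasFDerivAt.neg
  rwa [ContinuousLinearMap.comp_neg] at h

lemma contDiff_residual (hG : ContDiff ℝ 2 G) : ContDiff ℝ 1 (residual G) := by
  have h (x) := hasFDerivAt_residual ((hG.differentiable two_ne_zero) x)
  rw [contDiff_one_iff_fderiv]
  refine ⟨fun x => (h x).differentiableAt, ?_⟩
  rw [show fderiv ℝ (residual G) = _ from funext fun x => (h x).fderiv]
  have h1 : Continuous fun x => SymMat.proj (-G x) :=
    SymMat.continuous_proj.comp hG.continuous.neg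
  have h2 : Continuous (fderiv ℝ G) := hG.continuous_fderiv two_ne_zero
  exact (((innerSL ℝ).continuous.comp h1).clm_comp h2).neg

/-- The part `∇G(x) ∇G(x)^* + ζ₁² ℒ_{G(x)}²` of `N(x)`. -/
noncomputable def opM (G : EuclideanSpace ℝ (Fin n) → SymMat m) (ζ₁ : ℝ)
    (x : EuclideanSpace ℝ (Fin n)) : SymMat m →L[ℝ] SymMat m :=
  fderiv ℝ G x ∘L ContinuousLinearMap.adjoint (fderiv ℝ G x)
    + ζ₁ ^ 2 • (SymMat.jordanL (G x) ∘L SymMat.jordanL (G x))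

lemma opN_apply (ζ₁ ζ₂ : ℝ) (x : EuclideanSpace ℝ (Fin n)) (Z : SymMat m) :
    opN G ζ₁ ζ₂ x Z = opM G ζ₁ x Z + (ζ₂ ^ 2 * residual G x) • Z := rfl

lemma opM_apply (ζ₁ : ℝ) (x : EuclideanSpace ℝ (Fin n)) (Z : SymMat m) :
    opM G ζ₁ x Z = fderiv ℝ G x (ContinuousLinearMap.adjoint (fderiv ℝ G x) Z)
      + ζ₁ ^ 2 • SymMat.jordanL (G x) (SymMat.jordanL (G x) Z) := rfl

lemma contDiff_smul_id {X E : Type*} [NormedAddCommGroup X] [NormedSpace ℝ X]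
    [NormedAddCommGroup E] [NormedSpace ℝ E] {r : X → ℝ} (hr : ContDiff ℝ 1 r) :
    ContDiff ℝ 1 fun x => r x • ContinuousLinearMap.id ℝ E :=
  hr.smul contDiff_const

lemma contDiff_fderiv (hG : ContDiff ℝ 2 G) : ContDiff ℝ 1 (fderiv ℝ G) :=
  hG.fderiv_right (by norm_num)

lemma contDiff_adjoint_fderiv (hG : ContDiff ℝ 2 G) :
    ContDiff ℝ 1 fun x => ContinuousLinearMap.adjoint (fderiv ℝ G x) :=
  (ContinuousLinearMap.adjoint (𝕜 := ℝ) (E := EuclideanSpace ℝ (Fin n))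
    (F := SymMat m)).contDiff.comp (contDiff_fderiv hG)

lemma contDiff_jordanL (hG : ContDiff ℝ 2 G) : ContDiff ℝ 1 fun x => SymMat.jordanL (G x) := by
  have h : ContDiff ℝ 1 (SymMat.jordanCLM m) := ContinuousLinearMap.contDiff _
  exact h.comp (hG.of_le one_le_two)

lemma exists_norm_bilinear_le {E : Type*} [NormedAddCommGroup E] [NormedSpace ℝ E]
    (T : E →L[ℝ] E →L[ℝ] E) : ∃ K : ℝ, 0 ≤ K ∧ ∀ y z, ‖T y z‖ ≤ K * ‖y‖ * ‖z‖ :=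
  ⟨‖T‖, norm_nonneg T, T.le_opNorm₂⟩

lemma exists_norm_jordanL_le (m : ℕ) :
    ∃ K : ℝ, 0 ≤ K ∧ ∀ Y Z : SymMat m, ‖SymMat.jordanL Y Z‖ ≤ K * ‖Y‖ * ‖Z‖ :=
  exists_norm_bilinear_le (SymMat.jordanCLM m)

lemma contDiff_opM (hG : ContDiff ℝ 2 G) (ζ₁ : ℝ) : ContDiff ℝ 1 (opM G ζ₁) :=
  ((contDiff_fderiv hG).clm_comp (contDiff_adjoint_fderiv hG)).add
    (((contDiff_jordanL hG).clm_comp (contDiff_jordanL hG)).const_smul _)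

lemma contDiff_opN (hG : ContDiff ℝ 2 G) (ζ₁ ζ₂ : ℝ) : ContDiff ℝ 1 (opN G ζ₁ ζ₂) :=
  (contDiff_opM hG ζ₁).add
    (contDiff_smul_id (contDiff_const.mul (contDiff_residual hG)))

lemma inner_opM_left (ζ₁ : ℝ) (x : EuclideanSpace ℝ (Fin n)) (Y Z : SymMat m) :
    inner ℝ (opM G ζ₁ x Y) Z = (inner ℝ Y (opM G ζ₁ x Z) : ℝ) := by
  simp only [opM_apply, inner_add_left, inner_add_right, inner_smul_left, inner_smul_right,
    SymMat.inner_jordanL_left]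
  rw [← ContinuousLinearMap.adjoint_inner_right, ContinuousLinearMap.adjoint_inner_left]
  simp

lemma inner_opN_left (ζ₁ ζ₂ : ℝ) (x : EuclideanSpace ℝ (Fin n)) (Y Z : SymMat m) :
    inner ℝ (opN G ζ₁ ζ₂ x Y) Z = (inner ℝ Y (opN G ζ₁ ζ₂ x Z) : ℝ) := by
  simp only [opN_apply, inner_add_left, inner_add_right, inner_smul_left, inner_smul_right,
    inner_opM_left]
  simp

lemma inner_opM_self (ζ₁ : ℝ) (x : EuclideanSpace ℝ (Fin n)) (Z : SymMat m) :
    inner ℝ (opM G ζ₁ x Z) Z = ‖ContinuousLinearMap.adjoint (fderiv ℝ G x) Z‖ ^ 2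
      + ζ₁ ^ 2 * ‖SymMat.jordanL (G x) Z‖ ^ 2 := by
  rw [opM_apply, inner_add_left, ← ContinuousLinearMap.adjoint_inner_right,
    real_inner_self_eq_norm_sq, inner_smul_left, SymMat.inner_jordanL_left,
    real_inner_self_eq_norm_sq]
  simp

lemma residual_eq_zero_iff (x : EuclideanSpace ℝ (Fin n)) : residual G x = 0 ↔ IsFeasible G x := by
  simp [residual, IsFeasible, SymMat.proj_neg_eq_zero_iff]

lemma residual_nonneg (x : EuclideanSpace ℝ (Fin n)) : 0 ≤ residual G x := by
  unfold residual; positivity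

/-- `⟨MZ, Z⟩` is a sum of squares, so a kernel element satisfies `∇G^* Z = 0` and `G ∘ Z = 0`. It is
thus orthogonal to the image of `∇G` and to the lineality space, which together span everything. -/
lemma opM_injective {ζ₁ : ℝ} (hζ₁ : 0 < ζ₁) {x : EuclideanSpace ℝ (Fin n)}
    (hx : IsFeasible G x) (hnd : IsNondegenerate G x) : Function.Injective (opM G ζ₁ x) := by
  rw [injective_iff_map_eq_zero]
  intro Z hZ
  have h := inner_opM_self (G := G) ζ₁ x Z
  rw [hZ, inner_zero_left] at h
  have h1 : ContinuousLinearMap.adjoint (fderiv ℝ G x) Z = 0 := by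
    rw [← norm_eq_zero, ← sq_eq_zero_iff]
    nlinarith [sq_nonneg ‖ContinuousLinearMap.adjoint (fderiv ℝ G x) Z‖,
      mul_nonneg (sq_nonneg ζ₁) (sq_nonneg ‖SymMat.jordanL (G x) Z‖)]
  have h2 : SymMat.jordanL (G x) Z = 0 := by
    rw [h1, norm_zero, zero_pow two_ne_zero, zero_add, eq_comm] at h
    simpa [hζ₁.ne'] using h
  have h3 : Z ∈ lineality (posTangentConeAt (SymMat.psd m) (G x)) + Set.range (fderiv ℝ G x) :=
    hnd ▸ Set.mem_univ Z
  obtain ⟨H, hH, _, ⟨w, rfl⟩, hHw⟩ := Set.mem_add.1 h3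
  have h4 := SymMat.inner_eq_zero_of_mem_lineality
    (SymMat.mul_eq_zero_of_jordan_eq_zero hx h2) hH
  have h5 : inner ℝ Z Z = (0 : ℝ) := by
    nth_rewrite 2 [← hHw]
    rw [inner_add_right, h4, ← ContinuousLinearMap.adjoint_inner_left, h1]
    simp
  exact inner_self_eq_zero.1 h5

/-- At feasible points `r = 0` and `N = M`; elsewhere the term `ζ₂² r I` alone makes `N` positive
definite. -/
lemma opN_injective {ζ₁ ζ₂ : ℝ} (hζ₁ : 0 < ζ₁) (hζ₂ : 0 < ζ₂) {x : EuclideanSpace ℝ (Fin n)}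
    (hnd : IsFeasible G x → IsNondegenerate G x) : Function.Injective (opN G ζ₁ ζ₂ x) := by
  by_cases hx : IsFeasible G x
  · have h : ⇑(opN G ζ₁ ζ₂ x) = opM G ζ₁ x := by
      funext Z
      rw [opN_apply, (residual_eq_zero_iff x).2 hx, mul_zero, zero_smul, add_zero]
    exact h ▸ opM_injective hζ₁ hx (hnd hx)
  · rw [injective_iff_map_eq_zero]
    intro Z hZ
    have h := inner_opM_self (G := G) ζ₁ x Z
    have hr : 0 < residual G x :=
      (residual_nonneg x).lt_of_ne' fun h => hx ((residual_eq_zero_iff x).1 h)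
    have h1 : inner ℝ (opN G ζ₁ ζ₂ x Z) Z = (0 : ℝ) := by rw [hZ, inner_zero_left]
    rw [opN_apply, inner_add_left, h, inner_smul_left, real_inner_self_eq_norm_sq] at h1
    have h2 : 0 < ζ₂ ^ 2 * residual G x := by positivity
    have h3 : ζ₂ ^ 2 * residual G x * ‖Z‖ ^ 2 = 0 := by
      refine le_antisymm ?_ (by positivity)
      rw [← h1]
      exact le_add_of_nonneg_left (by positivity)
    simpa [h2.ne'] using h3

lemma apply_inverse_of_injective {E : Type*} [NormedAddCommGroup E] [NormedSpace ℝ E]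
    [FiniteDimensional ℝ E] {T : E →L[ℝ] E} (hT : Function.Injective T) (y : E) :
    T (T.inverse y) = y := by
  refine ContinuousLinearMap.IsInvertible.self_apply_inverse
    ⟨(LinearEquiv.ofInjectiveEndo (T : E →ₗ[ℝ] E) hT).toContinuousLinearEquiv, ?_⟩ y
  ext z
  rfl

lemma eventually_norm_le_of_injective {X E : Type*} [TopologicalSpace X] [NormedAddCommGroup E]
    [NormedSpace ℝ E] [FiniteDimensional ℝ E] {T : X → E →L[ℝ] E} {x : X} (hT : ContinuousAt T x)
    (h : Function.Injective (T x)) :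
    ∃ σ : ℝ, 0 < σ ∧ ∀ᶠ y in 𝓝 x, ∀ Z, σ * ‖Z‖ ≤ ‖T y Z‖ := by
  obtain ⟨K, hK, hT'⟩ := (T x : E →ₗ[ℝ] E).exists_antilipschitzWith (LinearMap.ker_eq_bot.2 h)
  refine ⟨(K : ℝ)⁻¹ / 2, by positivity, ?_⟩
  have hK' : (0 : ℝ) < (K : ℝ)⁻¹ / 2 := by positivity
  filter_upwards [Metric.tendsto_nhds.1 hT _ hK'] with y hy Z
  have h1 : ‖Z‖ ≤ K * ‖T x Z‖ := by
    simpa using hT'.le_mul_norm (map_zero _) Z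
  have h2 : (K : ℝ)⁻¹ * ‖Z‖ ≤ ‖T x Z‖ := by
    rwa [inv_mul_le_iff₀ (by exact_mod_cast hK)]
  have h3 : ‖(T y - T x) Z‖ ≤ (K : ℝ)⁻¹ / 2 * ‖Z‖ :=
    ((T y - T x).le_opNorm Z).trans
      (mul_le_mul_of_nonneg_right (by rw [← dist_eq_norm]; exact hy.le) (norm_nonneg Z))
  have h4 : ‖T x Z‖ ≤ ‖T y Z‖ + ‖(T y - T x) Z‖ := by
    have := norm_sub_le (T y Z) ((T y - T x) Z)
    simpa using this
  linarith

/-! ### Differentiating the augmented Lagrangian -/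

/-- The map `(x, Λ) ↦ N(x) (Λ(x) - Λ)`, written without the inverse of `N(x)`. -/
noncomputable def multiplierResidual (f : EuclideanSpace ℝ (Fin n) → ℝ)
    (G : EuclideanSpace ℝ (Fin n) → SymMat m) (ζ₁ ζ₂ : ℝ)
    (p : EuclideanSpace ℝ (Fin n) × SymMat m) : SymMat m :=
  fderiv ℝ G p.1 (gradient f p.1) - opN G ζ₁ ζ₂ p.1 p.2

/-- `N(x)` is invertible at every `x`, so `N(x)` cancels the inverse inside `Λ(x)`, and no operator
inverse has to be differentiated. -/
lemma augLagrangian_eq {ζ₁ ζ₂ : ℝ} (hζ₁ : 0 < ζ₁) (hζ₂ : 0 < ζ₂)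
    (hnd : ∀ y, IsFeasible G y → IsNondegenerate G y) (c : ℝ) :
    augLagrangian f G ζ₁ ζ₂ c = fun p => f p.1
      + 1 / (2 * c) * (‖SymMat.proj (p.2 - c • G p.1)‖ ^ 2 - ‖p.2‖ ^ 2)
      + ‖multiplierResidual f G ζ₁ ζ₂ p‖ ^ 2 := by
  funext p
  rw [augLagrangian, map_sub, multiplierEstimate,
    apply_inverse_of_injective (opN_injective hζ₁ hζ₂ (hnd p.1)), multiplierResidual]

lemma contDiff_gradient (hf : ContDiff ℝ 2 f) : ContDiff ℝ 1 (gradient f) :=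
  (InnerProductSpace.toDual ℝ (EuclideanSpace ℝ (Fin n))).symm.contDiff.comp
    (hf.fderiv_right (by norm_num))

lemma contDiff_multiplierResidual (hf : ContDiff ℝ 2 f) (hG : ContDiff ℝ 2 G) (ζ₁ ζ₂ : ℝ) :
    ContDiff ℝ 1 (multiplierResidual f G ζ₁ ζ₂) :=
  (((contDiff_fderiv hG).comp contDiff_fst).clm_apply ((contDiff_gradient hf).comp contDiff_fst)).sub
    (((contDiff_opN hG ζ₁ ζ₂).comp contDiff_fst).clm_apply contDiff_snd)

lemma fderiv_multiplierResidual_inr (hf : ContDiff ℝ 2 f) (hG : ContDiff ℝ 2 G) (ζ₁ ζ₂ : ℝ)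
    (p : EuclideanSpace ℝ (Fin n) × SymMat m) (H : SymMat m) :
    fderiv ℝ (multiplierResidual f G ζ₁ ζ₂) p (0, H) = -opN G ζ₁ ζ₂ p.1 H := by
  have h1 := (contDiff_multiplierResidual hf hG ζ₁ ζ₂).differentiable one_ne_zero p
  have h2 := h1.hasFDerivAt.comp p.2 (hasFDerivAt_prodMk_right (𝕜 := ℝ) p.1 p.2)
  have h3 : HasFDerivAt (multiplierResidual f G ζ₁ ζ₂ ∘ fun Λ => (p.1, Λ))
      (-opN G ζ₁ ζ₂ p.1) p.2 :=
    (opN G ζ₁ ζ₂ p.1).hasFDerivAt.const_sub (fderiv ℝ G p.1 (gradient f p.1))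
  exact DFunLike.congr_fun (h2.unique h3) H

lemma hasFDerivAt_augLagrangian (hf : ContDiff ℝ 2 f) (hG : ContDiff ℝ 2 G)
    (hnd : ∀ y, IsFeasible G y → IsNondegenerate G y)
    {ζ₁ ζ₂ : ℝ} (hζ₁ : 0 < ζ₁) (hζ₂ : 0 < ζ₂) (c : ℝ) (p : EuclideanSpace ℝ (Fin n) × SymMat m) :
    HasFDerivAt (augLagrangian f G ζ₁ ζ₂ c)
      (fderiv ℝ f p.1 ∘L .fst ℝ _ _
        + (c⁻¹ • (innerSL ℝ (SymMat.proj (p.2 - c • G p.1)) ∘L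
            (.snd ℝ _ _ - c • (fderiv ℝ G p.1 ∘L .fst ℝ _ _)) - innerSL ℝ p.2 ∘L .snd ℝ _ _))
        + (2 : ℝ) • (innerSL ℝ (multiplierResidual f G ζ₁ ζ₂ p) ∘L
            fderiv ℝ (multiplierResidual f G ζ₁ ζ₂) p)) p := by
  rw [augLagrangian_eq hζ₁ hζ₂ hnd]
  have h1 : HasFDerivAt (fun q : EuclideanSpace ℝ (Fin n) × SymMat m => f q.1) _ p :=
    (hf.differentiable two_ne_zero p.1).hasFDerivAt.comp p hasFDerivAt_fst
  have hG' : HasFDerivAt (fun q : EuclideanSpace ℝ (Fin n) × SymMat m => G q.1) _ p :=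
    (hG.differentiable two_ne_zero p.1).hasFDerivAt.comp p hasFDerivAt_fst
  have h2 := (SymMat.hasFDerivAt_half_norm_sq_proj (p.2 - c • G p.1)).comp p
    (hasFDerivAt_snd.sub (hG'.const_smul c))
  have h3 : HasFDerivAt (fun q : EuclideanSpace ℝ (Fin n) × SymMat m => ‖q.2‖ ^ 2) _ p :=
    hasFDerivAt_snd.norm_sq
  have h4 := ((contDiff_multiplierResidual hf hG ζ₁ ζ₂).differentiable
    one_ne_zero p).hasFDerivAt.norm_sq
  refine ((h1.add ((h2.sub (h3.const_smul (1 / 2 : ℝ))).const_smul c⁻¹)).add h4).congr_fderiv ?_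
    |>.congr_of_eventuallyEq (.of_forall fun q => ?_)
  · ext <;> simp
  · simp [smul_eq_mul]
    ring

end NSDP

/-! ### Consequences of stationarity -/

namespace NSDP

variable {n m : ℕ} {f : EuclideanSpace ℝ (Fin n) → ℝ} {G : EuclideanSpace ℝ (Fin n) → SymMat m}

/-- The projection `P(Λ - c G(x))`. -/
noncomputable def shiftProj (G : EuclideanSpace ℝ (Fin n) → SymMat m) (c : ℝ)
    (p : EuclideanSpace ℝ (Fin n) × SymMat m) : SymMat m :=
  SymMat.proj (p.2 - c • G p.1)

/-- The scaled multiplier step `(P(Λ - c G(x)) - Λ) / c`. -/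
noncomputable def multiplierStep (G : EuclideanSpace ℝ (Fin n) → SymMat m) (c : ℝ)
    (p : EuclideanSpace ℝ (Fin n) × SymMat m) : SymMat m :=
  c⁻¹ • (shiftProj G c p - p.2)

/-- The derivative of `multiplierResidual` with respect to `x`. -/
noncomputable def partialResidual (f : EuclideanSpace ℝ (Fin n) → ℝ)
    (G : EuclideanSpace ℝ (Fin n) → SymMat m) (ζ₁ ζ₂ : ℝ)
    (p : EuclideanSpace ℝ (Fin n) × SymMat m) : EuclideanSpace ℝ (Fin n) →L[ℝ] SymMat m :=
  fderiv ℝ (multiplierResidual f G ζ₁ ζ₂) p ∘L .inl ℝ _ _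

lemma continuous_partialResidual (hf : ContDiff ℝ 2 f) (hG : ContDiff ℝ 2 G) (ζ₁ ζ₂ : ℝ) :
    Continuous (partialResidual f G ζ₁ ζ₂) :=
  ((contDiff_multiplierResidual hf hG ζ₁ ζ₂).continuous_fderiv one_ne_zero).clm_comp
    continuous_const

lemma shiftProj_eq {c : ℝ} (hc : 0 < c) (p : EuclideanSpace ℝ (Fin n) × SymMat m) :
    shiftProj G c p = p.2 + c • multiplierStep G c p := by
  rw [multiplierStep, smul_inv_smul₀ hc.ne']
  abel

/-- Positive homogeneity of `P` absorbs the factor `c`; the limit as `c → ∞` is read off from this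
form. -/
lemma multiplierStep_eq {c : ℝ} (hc : 0 < c) (p : EuclideanSpace ℝ (Fin n) × SymMat m) :
    multiplierStep G c p = SymMat.proj (c⁻¹ • p.2 - G p.1) - c⁻¹ • p.2 := by
  rw [multiplierStep, shiftProj, smul_sub, ← SymMat.proj_smul _ (inv_nonneg.2 hc.le), smul_sub,
    inv_smul_smul₀ hc.ne']

lemma shiftProj_sub_eq {c : ℝ} (hc : 0 < c) (p : EuclideanSpace ℝ (Fin n) × SymMat m) :
    shiftProj G c p - (p.2 - c • G p.1) = c • (G p.1 + multiplierStep G c p) := by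
  rw [shiftProj_eq hc, smul_add]
  abel

lemma add_multiplierStep_mem_psd {c : ℝ} (hc : 0 < c) (p : EuclideanSpace ℝ (Fin n) × SymMat m) :
    G p.1 + multiplierStep G c p ∈ SymMat.psd m := by
  have h := SymMat.smul_mem_psd (SymMat.proj_sub_self_mem_psd (p.2 - c • G p.1))
    (inv_nonneg.2 hc.le)
  rwa [← shiftProj, shiftProj_sub_eq hc, inv_smul_smul₀ hc.ne'] at h

/-- In Moreau's decomposition of `Λ - cG`, the parts `U` and `c(G + S)` are complementary, so `(G +
S) ∘ U = 0`. -/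
lemma jordanL_shiftProj {c : ℝ} (hc : 0 < c) (p : EuclideanSpace ℝ (Fin n) × SymMat m) :
    SymMat.jordanL (G p.1) (shiftProj G c p)
      = -SymMat.jordanL (multiplierStep G c p) (shiftProj G c p) := by
  have h := SymMat.jordan_proj_proj_sub (p.2 - c • G p.1)
  rw [← shiftProj, shiftProj_sub_eq hc, SymMat.jordan_comm] at h
  change SymMat.jordanCLM m _ _ = 0 at h
  rw [map_smul, map_add, _root_.smul_apply, _root_.add_apply] at h
  exact eq_neg_of_add_eq_zero_left ((smul_eq_zero_iff_right hc.ne').1 h)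

lemma residual_le {c : ℝ} (hc : 0 < c) (p : EuclideanSpace ℝ (Fin n) × SymMat m) :
    residual G p.1 ≤ 1 / 2 * ‖multiplierStep G c p‖ ^ 2 := by
  have := SymMat.norm_proj_neg_le (add_multiplierStep_mem_psd (G := G) hc p)
  unfold residual
  gcongr

lemma tendsto_multiplierStep (hG : Continuous G) {x : ℕ → EuclideanSpace ℝ (Fin n)}
    {Λ : ℕ → SymMat m} {c : ℕ → ℝ} (hc_pos : ∀ k, 0 < c k) (hc : Tendsto c atTop atTop)
    {xhat : EuclideanSpace ℝ (Fin n)} {Λhat : SymMat m} (hx : Tendsto x atTop (𝓝 xhat))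
    (hΛ : Tendsto Λ atTop (𝓝 Λhat)) :
    Tendsto (fun k => multiplierStep G (c k) (x k, Λ k)) atTop (𝓝 (SymMat.proj (-G xhat))) := by
  have h1 : Tendsto (fun k => (c k)⁻¹ • Λ k) atTop (𝓝 0) := by
    simpa using hc.inv_tendsto_atTop.smul hΛ
  have h2 := (SymMat.continuous_proj.tendsto _).comp (h1.sub ((hG.tendsto xhat).comp hx))
  simpa [multiplierStep_eq (hc_pos _), Function.comp_def] using h2.sub h1

section Stationary

variable {ζ₁ ζ₂ c : ℝ} {p : EuclideanSpace ℝ (Fin n) × SymMat m}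

lemma multiplierStep_eq_of_isStationary (hf : ContDiff ℝ 2 f) (hG : ContDiff ℝ 2 G)
    (hnd : ∀ y, IsFeasible G y → IsNondegenerate G y) (hζ₁ : 0 < ζ₁) (hζ₂ : 0 < ζ₂)
    (hs : IsStationary (augLagrangian f G ζ₁ ζ₂ c) p) :
    multiplierStep G c p = (2 : ℝ) • opN G ζ₁ ζ₂ p.1 (multiplierResidual f G ζ₁ ζ₂ p) := by
  have h := hs.unique (hasFDerivAt_augLagrangian hf hG hnd hζ₁ hζ₂ c p)
  refine ext_inner_right ℝ fun H => ?_
  have h1 := DFunLike.congr_fun h ((0 : EuclideanSpace ℝ (Fin n)), H)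
  simp [fderiv_multiplierResidual_inr hf hG] at h1
  rw [multiplierStep, inner_smul_left, inner_sub_left, inner_smul_left, inner_opN_left, shiftProj]
  simp
  linarith

lemma adjoint_shiftProj_of_isStationary (hf : ContDiff ℝ 2 f) (hG : ContDiff ℝ 2 G)
    (hnd : ∀ y, IsFeasible G y → IsNondegenerate G y) (hζ₁ : 0 < ζ₁) (hζ₂ : 0 < ζ₂) (hc : 0 < c)
    (hs : IsStationary (augLagrangian f G ζ₁ ζ₂ c) p) :
    ContinuousLinearMap.adjoint (fderiv ℝ G p.1) (shiftProj G c p) = gradient f p.1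
      + (2 : ℝ) • ContinuousLinearMap.adjoint (partialResidual f G ζ₁ ζ₂ p)
        (multiplierResidual f G ζ₁ ζ₂ p) := by
  have h := hs.unique (hasFDerivAt_augLagrangian hf hG hnd hζ₁ hζ₂ c p)
  refine ext_inner_right ℝ fun w => ?_
  have h1 := DFunLike.congr_fun h (w, (0 : SymMat m))
  rw [ContinuousLinearMap.adjoint_inner_left, inner_add_left, inner_smul_left,
    ContinuousLinearMap.adjoint_inner_left, partialResidual, shiftProj]
  simp [hc.ne'] at h1
  simp [gradient]
  linarith

/-- At a stationary point of the augmented Lagrangian, the image of `P(Λ - c G(x)) - Λ` under the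
regular part of `N(x)` is of lower order. -/
lemma opM_shiftProj_sub (hf : ContDiff ℝ 2 f) (hG : ContDiff ℝ 2 G)
    (hnd : ∀ y, IsFeasible G y → IsNondegenerate G y) (hζ₁ : 0 < ζ₁) (hζ₂ : 0 < ζ₂) (hc : 0 < c)
    (hs : IsStationary (augLagrangian f G ζ₁ ζ₂ c) p) :
    opM G ζ₁ p.1 (shiftProj G c p - p.2) = multiplierResidual f G ζ₁ ζ₂ p
      + (2 : ℝ) • fderiv ℝ G p.1 (ContinuousLinearMap.adjoint (partialResidual f G ζ₁ ζ₂ p)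
        (multiplierResidual f G ζ₁ ζ₂ p))
      + (ζ₂ ^ 2 * residual G p.1) • p.2
      - ζ₁ ^ 2 • SymMat.jordanL (G p.1)
        (SymMat.jordanL (multiplierStep G c p) (shiftProj G c p)) := by
  rw [map_sub, opM_apply ζ₁ p.1 (shiftProj G c p), jordanL_shiftProj hc, map_neg, smul_neg,
    adjoint_shiftProj_of_isStationary hf hG hnd hζ₁ hζ₂ hc hs, map_add, map_smul]
  -- Substituting `∇G ∇f = F + NΛ` cancels `MΛ` and leaves only `ζ₂² r Λ`.
  have h : fderiv ℝ G p.1 (gradient f p.1)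
      = multiplierResidual f G ζ₁ ζ₂ p + opN G ζ₁ ζ₂ p.1 p.2 := (sub_add_cancel _ _).symm
  rw [h, opN_apply]
  abel

/-- Each term of `opM_shiftProj_sub` is of order `‖S‖`: `F` because `S = 2NF` with `N` bounded
below, `r` because `r ≤ ½‖S‖²`, and the Jordan term through `S ∘ U`. The summand `c‖S‖` in the
bracket comes from `‖U‖ ≤ ‖Λ‖ + c‖S‖`. -/
lemma norm_shiftProj_sub_le (hf : ContDiff ℝ 2 f) (hG : ContDiff ℝ 2 G)
    (hnd : ∀ y, IsFeasible G y → IsNondegenerate G y) (hζ₁ : 0 < ζ₁) (hζ₂ : 0 < ζ₂) (hc : 0 < c)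
    (hs : IsStationary (augLagrangian f G ζ₁ ζ₂ c) p) {σ K : ℝ} (hσ : 0 < σ)
    (hK : 0 ≤ K) (hJ : ∀ Y Z : SymMat m, ‖SymMat.jordanL Y Z‖ ≤ K * ‖Y‖ * ‖Z‖)
    (hM : ∀ Z, σ * ‖Z‖ ≤ ‖opM G ζ₁ p.1 Z‖) (hN : ∀ Z, σ * ‖Z‖ ≤ ‖opN G ζ₁ ζ₂ p.1 Z‖) :
    σ * (c * ‖multiplierStep G c p‖) ≤ ‖multiplierStep G c p‖ *
      (1 / (2 * σ) * (1 + 2 * (‖fderiv ℝ G p.1‖ * ‖partialResidual f G ζ₁ ζ₂ p‖))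
        + ζ₂ ^ 2 * (1 / 2 * ‖multiplierStep G c p‖) * ‖p.2‖
        + ζ₁ ^ 2 * (‖SymMat.jordanL (G p.1)‖
          * (K * (‖p.2‖ + c * ‖multiplierStep G c p‖)))) := by
  set S := multiplierStep G c p
  set F := multiplierResidual f G ζ₁ ζ₂ p
  set D := partialResidual f G ζ₁ ζ₂ p
  set A := fderiv ℝ G p.1
  set U := shiftProj G c p
  have hU : U = p.2 + c • S := shiftProj_eq hc p
  have hUn : ‖U‖ ≤ ‖p.2‖ + c * ‖S‖ := by
    rw [hU]
    refine (norm_add_le _ _).trans_eq ?_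
    rw [norm_smul, Real.norm_of_nonneg hc.le]
  have hF : ‖F‖ ≤ 1 / (2 * σ) * ‖S‖ := by
    have h1 := hN F
    have h2 : ‖S‖ = 2 * ‖opN G ζ₁ ζ₂ p.1 F‖ := by
      rw [show S = _ from multiplierStep_eq_of_isStationary hf hG hnd hζ₁ hζ₂ hs, norm_smul]
      simp [F]
    rw [div_mul_eq_mul_div, one_mul, le_div_iff₀ (by positivity)]
    linarith
  have hAD : ‖A (ContinuousLinearMap.adjoint D F)‖ ≤ ‖A‖ * (‖D‖ * ‖F‖) := by
    refine (A.le_opNorm _).trans ?_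
    gcongr
    refine (ContinuousLinearMap.le_opNorm _ _).trans_eq ?_
    rw [LinearIsometryEquiv.norm_map]
  have hL : ‖SymMat.jordanL (G p.1) (SymMat.jordanL S U)‖
      ≤ ‖SymMat.jordanL (G p.1)‖ * (K * ‖S‖ * (‖p.2‖ + c * ‖S‖)) := by
    refine (ContinuousLinearMap.le_opNorm _ _).trans ?_
    gcongr
    refine (hJ S U).trans ?_
    gcongr
  have hr := residual_le (G := G) hc p
  have hr0 := residual_nonneg (G := G) p.1
  have key := hM (U - p.2)
  rw [opM_shiftProj_sub hf hG hnd hζ₁ hζ₂ hc hs, show ‖U - p.2‖ = c * ‖S‖ by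
    rw [hU, add_sub_cancel_left, norm_smul, Real.norm_of_nonneg hc.le]] at key
  have h1 : ‖(2 : ℝ) • A (ContinuousLinearMap.adjoint D F)‖ ≤ 2 * (‖A‖ * (‖D‖ * ‖F‖)) := by
    rw [norm_smul, Real.norm_of_nonneg zero_le_two]
    gcongr
  have h2 : ‖(ζ₂ ^ 2 * residual G p.1) • p.2‖ ≤ ζ₂ ^ 2 * (1 / 2 * ‖S‖ ^ 2) * ‖p.2‖ := by
    rw [norm_smul, Real.norm_of_nonneg (by positivity)]
    gcongr
  have h3 : ‖ζ₁ ^ 2 • SymMat.jordanL (G p.1) (SymMat.jordanL S U)‖ ≤ ζ₁ ^ 2 *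
      (‖SymMat.jordanL (G p.1)‖ * (K * ‖S‖ * (‖p.2‖ + c * ‖S‖))) := by
    rw [norm_smul, Real.norm_of_nonneg (by positivity)]
    gcongr
  have h4 : ‖F‖ + 2 * (‖A‖ * (‖D‖ * ‖F‖)) ≤ 1 / (2 * σ) * ‖S‖ * (1 + 2 * (‖A‖ * ‖D‖)) := by
    rw [show ‖F‖ + 2 * (‖A‖ * (‖D‖ * ‖F‖)) = ‖F‖ * (1 + 2 * (‖A‖ * ‖D‖)) by ring]
    gcongr
  refine key.trans ((norm_sub_le _ _).trans ((add_le_add ((norm_add_le _ _).trans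
    (add_le_add (norm_add_le _ _) le_rfl)) le_rfl).trans ?_))
  change ‖F‖ + ‖(2 : ℝ) • A (ContinuousLinearMap.adjoint D F)‖ + _ + _ ≤ _
  linarith

lemma isKKT_of_multiplierStep_eq_zero (hf : ContDiff ℝ 2 f) (hG : ContDiff ℝ 2 G)
    (hnd : ∀ y, IsFeasible G y → IsNondegenerate G y) (hζ₁ : 0 < ζ₁) (hζ₂ : 0 < ζ₂) (hc : 0 < c)
    (hs : IsStationary (augLagrangian f G ζ₁ ζ₂ c) p) (h0 : multiplierStep G c p = 0) :
    IsKKT f G p.1 p.2 := by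
  have hU : shiftProj G c p = p.2 := by rw [shiftProj_eq hc, h0, smul_zero, add_zero]
  have hF : multiplierResidual f G ζ₁ ζ₂ p = 0 := by
    have h1 := multiplierStep_eq_of_isStationary hf hG hnd hζ₁ hζ₂ hs
    rw [h0, eq_comm, smul_eq_zero_iff_right two_ne_zero] at h1
    exact (injective_iff_map_eq_zero _).1 (opN_injective hζ₁ hζ₂ (hnd p.1)) _ h1
  refine ⟨?_, ?_, ?_, ?_⟩
  · have h1 := adjoint_shiftProj_of_isStationary hf hG hnd hζ₁ hζ₂ hc hs
    rw [hU, hF, map_zero, smul_zero, add_zero] at h1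
    have h2 := (hf.differentiable two_ne_zero p.1).hasFDerivAt.sub
      ((hG.differentiable two_ne_zero p.1).hasFDerivAt.inner ℝ (hasFDerivAt_const p.2 p.1))
    refine h2.congr_fderiv ?_
    ext w
    have h3 : inner ℝ (gradient f p.1) w = inner ℝ p.2 (fderiv ℝ G p.1 w) := by
      rw [← h1, ContinuousLinearMap.adjoint_inner_left]
    simp [gradient] at h3
    simp [h3, real_inner_comm]
  · have h1 := jordanL_shiftProj (G := G) hc p
    rw [hU, h0] at h1
    rw [SymMat.jordan_comm]
    refine h1.trans ?_
    rw [← SymMat.jordanCLM_apply, map_zero, _root_.zero_apply, neg_zero]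
  · have h1 := add_multiplierStep_mem_psd (G := G) hc p
    rwa [h0, add_zero] at h1
  · rw [← hU]
    exact SymMat.proj_mem _

end Stationary

/-! ### Passage to the limit -/

lemma isStationary_residual_of_tendsto (hf : ContDiff ℝ 2 f) (hG : ContDiff ℝ 2 G)
    (hnd : ∀ y, IsFeasible G y → IsNondegenerate G y) {ζ₁ ζ₂ : ℝ} (hζ₁ : 0 < ζ₁) (hζ₂ : 0 < ζ₂)
    {x : ℕ → EuclideanSpace ℝ (Fin n)} {Λ : ℕ → SymMat m} {c : ℕ → ℝ} (hc_pos : ∀ k, 0 < c k)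
    (hc : Tendsto c atTop atTop)
    (hstat : ∀ k, IsStationary (augLagrangian f G ζ₁ ζ₂ (c k)) (x k, Λ k))
    {xhat : EuclideanSpace ℝ (Fin n)} {Λhat : SymMat m} (hx : Tendsto x atTop (𝓝 xhat))
    (hΛ : Tendsto Λ atTop (𝓝 Λhat)) : IsStationary (residual G) xhat := by
  have hp := hx.prodMk_nhds hΛ
  have hinv := hc.inv_tendsto_atTop
  have hS := tendsto_multiplierStep hG.continuous hc_pos hc hx hΛ
  have hU : Tendsto (fun k => (c k)⁻¹ • shiftProj G (c k) (x k, Λ k)) atTop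
      (𝓝 (SymMat.proj (-G xhat))) := by
    have := (hinv.smul hΛ).add hS
    simp only [zero_smul, zero_add] at this
    refine this.congr fun k => ?_
    rw [shiftProj_eq (hc_pos k), smul_add, inv_smul_smul₀ (hc_pos k).ne']
    rfl
  have h1 := ((((contDiff_adjoint_fderiv hG).continuous.comp continuous_fst).clm_apply
    continuous_snd).tendsto (xhat, SymMat.proj (-G xhat))).comp (hx.prodMk_nhds hU)
  have hDF := ((((ContinuousLinearMap.adjoint (𝕜 := ℝ) (E := EuclideanSpace ℝ (Fin n))
    (F := SymMat m)).continuous.comp (continuous_partialResidual hf hG ζ₁ ζ₂)).clm_apply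
    (contDiff_multiplierResidual hf hG ζ₁ ζ₂).continuous).tendsto _).comp hp
  have hg := ((contDiff_gradient hf).continuous.tendsto xhat).comp hx
  -- The right side of the `x` equation stays bounded, so it vanishes after division by `c`, while
  -- `U/c` has the same limit as `S`.
  have h2 := hinv.smul (hg.add (hDF.const_smul (2 : ℝ)))
  rw [zero_smul] at h2
  have h3 : ContinuousLinearMap.adjoint (fderiv ℝ G xhat) (SymMat.proj (-G xhat)) = 0 := by
    refine tendsto_nhds_unique h1 (h2.congr fun k => ?_)
    simp only [Function.comp_apply, Pi.inv_apply, map_smul]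
    rw [← adjoint_shiftProj_of_isStationary hf hG hnd hζ₁ hζ₂ (hc_pos k) (hstat k)]
  refine (hasFDerivAt_residual (hG.differentiable two_ne_zero xhat)).congr_fderiv ?_
  ext w
  have h4 : inner ℝ (SymMat.proj (-G xhat)) (fderiv ℝ G xhat w) = (0 : ℝ) := by
    rw [← ContinuousLinearMap.adjoint_inner_left, h3, inner_zero_left]
  simp [h4]

lemma tendsto_norm_apply {X E : Type*} [TopologicalSpace X] [NormedAddCommGroup E] {T : X → E}
    (hT : Continuous T) {x : ℕ → X} {a : X} (hx : Tendsto x atTop (𝓝 a)) :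
    Tendsto (fun k => ‖T (x k)‖) atTop (𝓝 ‖T a‖) :=
  ((hT.tendsto a).comp hx).norm

lemma eventually_isKKT (hf : ContDiff ℝ 2 f) (hG : ContDiff ℝ 2 G)
    (hnd : ∀ y, IsFeasible G y → IsNondegenerate G y) {ζ₁ ζ₂ : ℝ} (hζ₁ : 0 < ζ₁) (hζ₂ : 0 < ζ₂)
    {x : ℕ → EuclideanSpace ℝ (Fin n)} {Λ : ℕ → SymMat m} {c : ℕ → ℝ} (hc_pos : ∀ k, 0 < c k)
    (hc : Tendsto c atTop atTop)
    (hstat : ∀ k, IsStationary (augLagrangian f G ζ₁ ζ₂ (c k)) (x k, Λ k))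
    {xhat : EuclideanSpace ℝ (Fin n)} {Λhat : SymMat m} (hx : Tendsto x atTop (𝓝 xhat))
    (hΛ : Tendsto Λ atTop (𝓝 Λhat)) (hfeas : IsFeasible G xhat) :
    ∀ᶠ k in atTop, IsKKT f G (x k) (Λ k) := by
  obtain ⟨σ₁, hσ₁, hM⟩ := eventually_norm_le_of_injective
    ((contDiff_opM hG ζ₁).continuous.continuousAt (x := xhat))
    (opM_injective hζ₁ hfeas (hnd _ hfeas))
  obtain ⟨σ₂, hσ₂, hN⟩ := eventually_norm_le_of_injective
    ((contDiff_opN hG ζ₁ ζ₂).continuous.continuousAt (x := xhat))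
    (opN_injective hζ₁ hζ₂ (hnd xhat))
  have hp := hx.prodMk_nhds hΛ
  have hS := tendsto_multiplierStep hG.continuous hc_pos hc hx hΛ
  rw [(SymMat.proj_neg_eq_zero_iff _).2 hfeas] at hS
  have hSn := hS.norm
  rw [norm_zero] at hSn
  have hA : Tendsto (fun k => ‖fderiv ℝ G (x k)‖) atTop (𝓝 ‖fderiv ℝ G xhat‖) :=
    tendsto_norm_apply (contDiff_fderiv hG).continuous hx
  have hJ : Tendsto (fun k => ‖SymMat.jordanL (G (x k))‖) atTop (𝓝 ‖SymMat.jordanL (G xhat)‖) :=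
    tendsto_norm_apply (contDiff_jordanL hG).continuous hx
  have hD : Tendsto (fun k => ‖partialResidual f G ζ₁ ζ₂ (x k, Λ k)‖) atTop (𝓝 ‖partialResidual f G ζ₁ ζ₂ (xhat, Λhat)‖) :=
    tendsto_norm_apply (T := partialResidual f G ζ₁ ζ₂)
      (continuous_partialResidual hf hG ζ₁ ζ₂) hp
  obtain ⟨K, hK, hKJ⟩ := exists_norm_jordanL_le m
  set σ := min σ₁ σ₂
  have hσ : 0 < σ := lt_min hσ₁ hσ₂
  have hB := hc.inv_tendsto_atTop.mul ((((hA.mul hD).const_mul 2).const_add 1).const_mul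
    (1 / (2 * σ)) |>.add (((hSn.const_mul (1 / 2)).const_mul (ζ₂ ^ 2)).mul hΛ.norm) |>.add
    -- `hB` collects the bracket terms that stay bounded and hence vanish after division by `c`. The
    -- remaining term, proportional to `c‖S‖`, becomes a multiple of `‖S‖ → 0` and is added in
    -- `hB'`.
    ((hJ.mul (hΛ.norm.const_mul K)).const_mul (ζ₁ ^ 2)))
  have hB' := hB.add ((hJ.mul (hSn.const_mul K)).const_mul (ζ₁ ^ 2))
  simp only [zero_mul, mul_zero, zero_add] at hB'
  filter_upwards [hx.eventually hM, hx.eventually hN, hB'.eventually_lt_const hσ] with k hMk hNk hk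
  refine isKKT_of_multiplierStep_eq_zero hf hG hnd hζ₁ hζ₂ (hc_pos k) (hstat k) ?_
  by_contra hne
  have hpos : 0 < ‖multiplierStep G (c k) (x k, Λ k)‖ := norm_pos_iff.2 hne
  have key := norm_shiftProj_sub_le hf hG hnd hζ₁ hζ₂ (hc_pos k) (hstat k) hσ hK hKJ
    (fun Z => (mul_le_mul_of_nonneg_right (min_le_left _ _) (norm_nonneg Z)).trans (hMk Z))
    (fun Z => (mul_le_mul_of_nonneg_right (min_le_right _ _) (norm_nonneg Z)).trans (hNk Z))
  -- Cancelling `‖S‖ > 0` leaves `σ c` at most the bracket, against `hk` multiplied by `c`.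
  rw [← mul_assoc, mul_comm, mul_le_mul_iff_right₀ hpos] at key
  have hck := hc_pos k
  simp only [Pi.inv_apply] at hk
  refine absurd key (not_le.2 ?_)
  have h2 := mul_lt_mul_of_pos_right hk hck
  refine lt_of_eq_of_lt ?_ h2
  field_simp
  ring

end NSDP

theorem mainTheorem5 {n m : ℕ} (f : EuclideanSpace ℝ (Fin n) → ℝ)
    (G : EuclideanSpace ℝ (Fin n) → SymMat m)
    (hf : ContDiff ℝ 2 f) (hG : ContDiff ℝ 2 G)
    (hnd : ∀ y, NSDP.IsFeasible G y → NSDP.IsNondegenerate G y)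
    (ζ₁ ζ₂ : ℝ) (hζ₁ : 0 < ζ₁) (hζ₂ : 0 < ζ₂)
    (x : ℕ → EuclideanSpace ℝ (Fin n)) (Λ : ℕ → SymMat m) (c : ℕ → ℝ)
    (hc_pos : ∀ k, 0 < c k) (hc : Tendsto c atTop atTop)
    (hstat : ∀ k, NSDP.IsStationary (NSDP.augLagrangian f G ζ₁ ζ₂ (c k)) (x k, Λ k))
    (φ : ℕ → ℕ) (hφ : StrictMono φ)
    (xhat : EuclideanSpace ℝ (Fin n)) (Λhat : SymMat m)
    (hx : Tendsto (fun j => x (φ j)) atTop (𝓝 xhat))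
    (hΛ : Tendsto (fun j => Λ (φ j)) atTop (𝓝 Λhat)) :
    (∃ khat : ℕ, 0 < khat ∧ ∀ j, khat ≤ φ j → NSDP.IsKKT f G (x (φ j)) (Λ (φ j)))
      ∨ (NSDP.IsStationary (NSDP.residual G) xhat ∧ ¬ NSDP.IsFeasible G xhat) := by
  have hcφ := hc.comp hφ.tendsto_atTop
  by_cases hfeas : NSDP.IsFeasible G xhat
  · left
    obtain ⟨J, hJ⟩ := eventually_atTop.1 (NSDP.eventually_isKKT hf hG hnd hζ₁ hζ₂
      (fun k => hc_pos (φ k)) hcφ (fun k => hstat (φ k)) hx hΛ hfeas)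
    -- The successor makes `khat` positive and turns `khat ≤ φ j` into `φ J < φ j`, hence `J < j`.
    exact ⟨φ J + 1, Nat.succ_pos _, fun j hj => hJ j (hφ.lt_iff_lt.1 hj).le⟩
  · exact Or.inr ⟨NSDP.isStationary_residual_of_tendsto hf hG hnd hζ₁ hζ₂
      (fun k => hc_pos (φ k)) hcφ (fun k => hstat (φ k)) hx hΛ, hfeas⟩
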